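/- Consider the varying binary symmetric channel (VBSC): input and output are binary, and in the $i$-th channel use the output $y_i$ differs from the input $x_i$ with probability $p_i$, where the crossover probabilities $p_1,p_2,\ldots$ are drawn i.i.d. from a probability density function $f_P$ on $[0,1]$ and, given the $p_i$ and the inputs, the outputs are independent. The crossover probabilities are known causally at the encoder and are unknown at the decoder, while $f_P$ is known to both: a code with $M$ messages and block length $n$ consists of measurable encoding functions $c_i=c_i(m,p_1,\ldots,p_i)\in\{0,1\}$, $1\le i\le n$, $m\in\{1,\ldots,M\}$, and of a decoder that estimates $m$ from $y_1,\ldots,y_n$. A rate $R\ge 0$ is achievable if there are such codes with $\lceil 2^{nR}\rceil$ messages for every block length $n$ whose error probability, averaged over a uniformly distributed message, tends to $0$ as $n\to\infty$; the capacity $C_{VBSC-E}$ is the supremum of the achievable rates. Then, with $H_2(q)=-q\log_2 q-(1-q)\log_2(1-q)$ (and $0\log_2 0=0$), $$C_{VBSC-E} = 1-H_2\left(\int_0^{1/2} f_P(p)(1-p)\,dp+\int_{1/2}^1 f_P(p)\,p\,dp\right).$$ -/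

import Mathlib

open MeasureTheory Filter Topology

/-- The binary entropy function to the base `2`, with the convention `0 log 0 = 0`. -/
noncomputable def H2 (p : ℝ) : ℝ :=
  -p * Real.logb 2 p - (1 - p) * Real.logb 2 (1 - p)

namespace VBSC

/-- The law on the real line with density `f` with respect to Lebesgue measure. -/
noncomputable def stateLaw (f : ℝ → ℝ) : Measure ℝ :=
  volume.withDensity (fun p => ENNReal.ofReal (f p))

/-- The probability that a binary symmetric channel with crossover probability `p`
outputs `y` when its input is `x`. -/
def bsc (p : ℝ) (x y : Bool) : ℝ := if y = x then 1 - p else p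

/-- A block code with `M` messages and block length `n` for a binary channel whose states are
known causally at the encoder and unknown at the decoder: the `i`-th codeword symbol is
`c i m (p 1, …, p i)`, a (measurable) function of the message and of the states up to and
including time `i`; the decoder sees only the `n` channel outputs. -/
structure CausalCode (M n : ℕ) where
  enc : (i : Fin n) → Fin M → (Set.Iic i → ℝ) → Bool
  measurable_enc : ∀ i m, Measurable (enc i m)
  dec : (Fin n → Bool) → Fin M

namespace CausalCode

variable {M n : ℕ}

/-- The codeword sent for the message `m` when the state sequence is `p`. -/
def codeword (C : CausalCode M n) (m : Fin M) (p : Fin n → ℝ) (i : Fin n) : Bool :=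
  C.enc i m (fun j => p j)

/-- The probability that the decoder does not return `m` although `m` was sent. The states are
i.i.d. with density `f`; given the states and the codeword, the outputs are independent, the
`i`-th one being produced by a binary symmetric channel with crossover probability `p i`. -/
noncomputable def errorProb (f : ℝ → ℝ) (C : CausalCode M n) (m : Fin M) : ℝ :=
  ∫ p : Fin n → ℝ,
    (∑ y : Fin n → Bool with C.dec y ≠ m, ∏ i, bsc (p i) (C.codeword m p i) (y i))
    ∂(Measure.pi fun _ => stateLaw f)

/-- The error probability averaged over a uniformly distributed message. -/
noncomputable def avgErrorProb (f : ℝ → ℝ) (C : CausalCode M n) : ℝ :=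
  (∑ m, C.errorProb f m) / M

end CausalCode

/-- The rate `R` (in bits per channel use) is achievable with causal state information at the
encoder: there are codes with `⌈2 ^ (n R)⌉` messages and block length `n`, for every `n`, whose
average error probability tends to `0`. -/
def Achievable (f : ℝ → ℝ) (R : ℝ) : Prop :=
  ∃ C : (n : ℕ) → CausalCode ⌈(2 : ℝ) ^ ((n : ℝ) * R)⌉₊ n,
    Tendsto (fun n => (C n).avgErrorProb f) atTop (𝓝 0)

/-- `c` is the capacity with causal state information only at the encoder: it is the least upper
bound of the achievable rates. -/
def IsCausalCapacity (f : ℝ → ℝ) (c : ℝ) : Prop :=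
  IsLUB {R : ℝ | 0 ≤ R ∧ Achievable f R} c

end VBSC

/-! Let `q` be the mean of `max p (1 - p)` under the state law, which is the argument of `H2` in the
theorem. Converse: the current state is independent of the past, so a causal input rule makes no
output bit more likely than `q`, given the past states. Convexity then bounds the sum of `r`-th
powers of the output probabilities, for `r ≥ 1`, by its value for `n` independent bits of bias `q`
(`sum_likelihood_rpow_le`). So each message's output law is about as spread out as `2 ^ (n * H2 q)`
outputs; as the decoding sets share `2 ^ n` outputs, rates above `1 - H2 q` fail
(`le_of_achievable`). Achievability: flipping the input whenever `p > 1 / 2` leaves, after averaging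
over the states, a memoryless symmetric channel of crossover `1 - q` (`likelihood_flipCode`). A
greedy Feinstein code on it attains all rates below `1 - H2 q` (`achievable_of_lt`). Both halves use
the threshold `2 ^ (t * n)` with `t` strictly between `R - 1` and `-H2 q`. -/

namespace VBSC

/-! ### Chernoff exponents and a convexity inequality -/

theorem hasDerivAt_rpow_one_add {q : ℝ} (hq : 0 ≤ q) :
    HasDerivAt (fun s : ℝ => q ^ (1 + s)) (q * Real.log q) 0 := by
  rcases hq.eq_or_lt with rfl | hq
  -- Near `s = 0` the exponent is nonzero, so the power vanishes; this matches `0 log 0 = 0`.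
  · have h : (fun s : ℝ => (0 : ℝ) ^ (1 + s)) =ᶠ[𝓝 0] fun _ => 0 := by
      filter_upwards [lt_mem_nhds (show (-1 : ℝ) < 0 by norm_num)] with s hs
      exact Real.zero_rpow (by linarith)
    simpa using (hasDerivAt_const (0 : ℝ) (0 : ℝ)).congr_of_eventuallyEq h
  · simpa [mul_comm] using ((hasDerivAt_id (0 : ℝ)).const_add 1).const_rpow hq

/-- The tilted sum equals `1` at `s = 0`, so the sign of this derivative decides on which side of
`0` it drops below `1`: the right for the converse, the left for achievability. -/
theorem hasDerivAt_tilt {q : ℝ} (hq : q ∈ Set.Icc (0 : ℝ) 1) (t : ℝ) :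
    HasDerivAt (fun s : ℝ => ((2 : ℝ) ^ t) ^ (-s) * (q ^ (1 + s) + (1 - q) ^ (1 + s)))
      (-(t + H2 q) * Real.log 2) 0 := by
  have h2 : (0 : ℝ) < 2 ^ t := by positivity
  have h := ((hasDerivAt_id (0 : ℝ)).neg.const_rpow h2).mul
    ((hasDerivAt_rpow_one_add hq.1).add (hasDerivAt_rpow_one_add (sub_nonneg.2 hq.2)))
  refine h.congr_deriv ?_
  have hlog : Real.log 2 ≠ 0 := (Real.log_pos one_lt_two).ne'
  simp only [Pi.neg_apply, Pi.add_apply, id, neg_zero, Real.rpow_zero, add_zero, Real.rpow_one,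
    Real.log_rpow two_pos, H2, Real.logb]
  field_simp
  ring

theorem exists_tilt_lt_one {q t : ℝ} (hq : q ∈ Set.Icc (0 : ℝ) 1) (ht : -H2 q < t) :
    ∃ s : ℝ, 0 < s ∧ ((2 : ℝ) ^ t) ^ (-s) * (q ^ (1 + s) + (1 - q) ^ (1 + s)) < 1 := by
  have h := hasDerivAt_iff_tendsto_slope.1 (hasDerivAt_tilt hq t)
  have hneg : -(t + H2 q) * Real.log 2 < 0 :=
    mul_neg_of_neg_of_pos (by linarith) (Real.log_pos one_lt_two)
  obtain ⟨s, hs, hs0⟩ := (((h.mono_left (nhdsGT_le_nhdsNE 0)).eventually (gt_mem_nhds hneg)).and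
    self_mem_nhdsWithin).exists
  have hs0 : 0 < s := hs0
  refine ⟨s, hs0, ?_⟩
  rw [slope_def_field, div_neg_iff] at hs
  simp only [sub_zero, neg_zero, Real.rpow_zero, add_zero, Real.rpow_one] at hs
  rcases hs with hs | hs <;> linarith [hs.1, hs.2]

theorem exists_neg_tilt_lt_one {q t : ℝ} (hq : q ∈ Set.Icc (0 : ℝ) 1) (ht : t < -H2 q) :
    ∃ s : ℝ, 0 < s ∧ s < 1 ∧ ((2 : ℝ) ^ t) ^ s * (q ^ (1 - s) + (1 - q) ^ (1 - s)) < 1 := by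
  have h := hasDerivAt_iff_tendsto_slope.1 (hasDerivAt_tilt hq t)
  have hpos : 0 < -(t + H2 q) * Real.log 2 :=
    mul_pos (by linarith) (Real.log_pos one_lt_two)
  obtain ⟨s, ⟨hs, hs0⟩, hs1⟩ :=
    (((h.mono_left (nhdsLT_le_nhdsNE 0)).eventually (lt_mem_nhds hpos)).and
    self_mem_nhdsWithin |>.and (mem_nhdsWithin_of_mem_nhds
      (lt_mem_nhds (show (-1 : ℝ) < 0 by norm_num)))).exists
  have hs0 : s < 0 := hs0
  have hs1 : -1 < s := hs1
  refine ⟨-s, by linarith, by linarith, ?_⟩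
  rw [slope_def_field, div_pos_iff] at hs
  simp only [sub_zero, neg_zero, Real.rpow_zero, add_zero, Real.rpow_one] at hs
  rw [sub_neg_eq_add]
  rcases hs with hs | hs <;> linarith [hs.1, hs.2]

/-- Splitting a mass `u + v` so that neither part exceeds the fraction `q` of the total increases
the sum of the `r`-th powers at most by the factor for the extreme split. -/
theorem rpow_add_rpow_le {q u v r : ℝ} (hq : q ∈ Set.Icc (0 : ℝ) 1) (hr : 1 ≤ r)
    (hw : 0 ≤ u + v) (hu : u ≤ q * (u + v)) (hv : v ≤ q * (u + v)) :
    u ^ r + v ^ r ≤ (u + v) ^ r * (q ^ r + (1 - q) ^ r) := by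
  set w := u + v with hw_def
  have hle : (1 - q) * w ≤ q * w := by linarith
  -- The bound on `v` is the lower bound on `u`; `v` is the mirror image of `u`, with the same
  -- weights swapped.
  have hmem : u ∈ segment ℝ ((1 - q) * w) (q * w) := by
    rw [segment_eq_Icc hle]
    exact ⟨by linarith, hu⟩
  obtain ⟨a, b, ha, hb, hab, hu'⟩ := hmem
  have hv' : b • ((1 - q) * w) + a • (q * w) = v := by
    simp only [smul_eq_mul] at hu' ⊢
    linear_combination w * hab - hu' + hw_def
  have h1 : (0 : ℝ) ≤ (1 - q) * w := mul_nonneg (sub_nonneg.2 hq.2) hw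
  have h2 : (0 : ℝ) ≤ q * w := mul_nonneg hq.1 hw
  have hc := convexOn_rpow hr
  have hU := hc.2 h1 h2 ha hb hab
  have hV := hc.2 h1 h2 hb ha (by linarith)
  rw [hu'] at hU
  rw [hv'] at hV
  simp only [smul_eq_mul, Real.mul_rpow (sub_nonneg.2 hq.2) hw,
    Real.mul_rpow hq.1 hw] at hU hV
  calc u ^ r + v ^ r ≤ (a + b) * (w ^ r * (q ^ r + (1 - q) ^ r)) := by linarith
    _ = _ := by rw [hab, one_mul]

/-! ### Output probabilities of the state-averaged channel -/

theorem bsc_nonneg {p : ℝ} (hp : p ∈ Set.Icc (0 : ℝ) 1) (x y : Bool) : 0 ≤ bsc p x y := by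
  unfold bsc
  split_ifs <;> linarith [hp.1, hp.2]

theorem bsc_le_one {p : ℝ} (hp : p ∈ Set.Icc (0 : ℝ) 1) (x y : Bool) : bsc p x y ≤ 1 := by
  unfold bsc
  split_ifs <;> linarith [hp.1, hp.2]

theorem bsc_le_max (p : ℝ) (x y : Bool) : bsc p x y ≤ max p (1 - p) := by
  unfold bsc
  split_ifs <;> simp

theorem bsc_true_add_bsc_false (p : ℝ) (x : Bool) : bsc p x true + bsc p x false = 1 := by
  cases x <;> simp [bsc]

theorem sum_prod_bsc {n : ℕ} (p : Fin n → ℝ) (x : Fin n → Bool) :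
    ∑ y : Fin n → Bool, ∏ i, bsc (p i) (x i) (y i) = 1 := by
  rw [← Fintype.prod_sum]
  simp [bsc_true_add_bsc_false]

theorem measurable_bsc {α : Type*} [MeasurableSpace α] {g : α → ℝ} {c : α → Bool}
    (hg : Measurable g) (hc : Measurable c) (b : Bool) :
    Measurable fun a => bsc (g a) (c a) b := by
  unfold bsc
  exact Measurable.ite (measurableSet_eq_fun measurable_const hc) (measurable_const.sub hg) hg

variable {μ : Measure ℝ} [IsProbabilityMeasure μ] {n : ℕ}

theorem ae_pi_mem_Icc (hμ : ∀ᵐ p ∂μ, p ∈ Set.Icc (0 : ℝ) 1) (n : ℕ) :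
    ∀ᵐ p : Fin n → ℝ ∂Measure.pi fun _ => μ, ∀ i, p i ∈ Set.Icc (0 : ℝ) 1 :=
  ae_all_iff.2 fun _ => Measure.tendsto_eval_ae_ae hμ

theorem integrable_bsc (hμ : ∀ᵐ p ∂μ, p ∈ Set.Icc (0 : ℝ) 1) {c : ℝ → Bool} (hc : Measurable c)
    (b : Bool) : Integrable (fun p => bsc p (c p) b) μ := by
  refine Integrable.of_bound (measurable_bsc measurable_id hc b).aestronglyMeasurable 1 ?_
  filter_upwards [hμ] with p hp
  rw [Real.norm_of_nonneg (bsc_nonneg hp _ _)]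
  exact bsc_le_one hp _ _

theorem integrable_max (hμ : ∀ᵐ p ∂μ, p ∈ Set.Icc (0 : ℝ) 1) :
    Integrable (fun p => max p (1 - p)) μ := by
  refine Integrable.of_bound (by fun_prop) 1 ?_
  filter_upwards [hμ] with p hp
  rw [Real.norm_of_nonneg (le_max_of_le_left hp.1)]
  exact max_le hp.2 (by linarith [hp.1])

theorem integrable_prod_bsc (hμ : ∀ᵐ p ∂μ, p ∈ Set.Icc (0 : ℝ) 1)
    {c : Fin n → (Fin n → ℝ) → Bool} (hc : ∀ i, Measurable (c i)) (y : Fin n → Bool) :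
    Integrable (fun p => ∏ i, bsc (p i) (c i p) (y i)) (Measure.pi fun _ => μ) := by
  refine Integrable.of_bound (Finset.measurable_fun_prod _ fun i _ =>
    measurable_bsc (measurable_pi_apply i) (hc i) (y i)).aestronglyMeasurable 1 ?_
  filter_upwards [ae_pi_mem_Icc hμ n] with p hp
  rw [Real.norm_of_nonneg (Finset.prod_nonneg fun i _ => bsc_nonneg (hp i) _ _)]
  exact Finset.prod_le_one (fun i _ => bsc_nonneg (hp i) _ _) fun i _ => bsc_le_one (hp i) _ _

/-- The probability of the output `y` when the channel inputs are chosen by `c` from the states. -/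
noncomputable def likelihood (μ : Measure ℝ) (c : Fin n → (Fin n → ℝ) → Bool)
    (y : Fin n → Bool) : ℝ :=
  ∫ p, ∏ i, bsc (p i) (c i p) (y i) ∂Measure.pi fun _ => μ

theorem likelihood_nonneg (hμ : ∀ᵐ p ∂μ, p ∈ Set.Icc (0 : ℝ) 1)
    (c : Fin n → (Fin n → ℝ) → Bool) (y : Fin n → Bool) : 0 ≤ likelihood μ c y := by
  refine integral_nonneg_of_ae ?_
  filter_upwards [ae_pi_mem_Icc hμ n] with p hp
  exact Finset.prod_nonneg fun i _ => bsc_nonneg (hp i) _ _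

theorem sum_likelihood (hμ : ∀ᵐ p ∂μ, p ∈ Set.Icc (0 : ℝ) 1)
    {c : Fin n → (Fin n → ℝ) → Bool} (hc : ∀ i, Measurable (c i)) :
    ∑ y, likelihood μ c y = 1 := by
  unfold likelihood
  rw [← integral_finsetSum _ fun y _ => integrable_prod_bsc hμ hc y]
  simp [sum_prod_bsc]

/-! ### Causal inputs: peeling off the last channel use -/

/-- Inputs that at each time depend on the present and past states only. -/
def IsCausal (c : Fin n → (Fin n → ℝ) → Bool) : Prop :=
  ∀ i p p', (∀ j ≤ i, p j = p' j) → c i p = c i p'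

/-- The inputs at all times but the last. -/
def initInput (c : Fin (n + 1) → (Fin (n + 1) → ℝ) → Bool) (i : Fin n) (p : Fin n → ℝ) : Bool :=
  c i.castSucc (Fin.snoc (α := fun _ => ℝ) p 0)

theorem measurable_snoc :
    Measurable fun z : ℝ × (Fin n → ℝ) => (Fin.snoc (α := fun _ => ℝ) z.2 z.1 : Fin (n + 1) → ℝ) := by
  refine measurable_pi_iff.2 fun i => ?_
  refine Fin.lastCases ?_ (fun j => ?_) i
  · simpa using measurable_fst
  · simpa [Function.comp_def] using (measurable_pi_apply j).comp measurable_snd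

theorem measurable_initInput {c : Fin (n + 1) → (Fin (n + 1) → ℝ) → Bool}
    (hc : ∀ i, Measurable (c i)) (i : Fin n) : Measurable (initInput c i) :=
  (hc i.castSucc).comp (measurable_snoc.comp measurable_prodMk_left)

/-- By causality the dummy last state `0` in `initInput` is immaterial. -/
theorem IsCausal.castSucc_snoc {c : Fin (n + 1) → (Fin (n + 1) → ℝ) → Bool} (hc : IsCausal c)
    (i : Fin n) (p : Fin n → ℝ) (x : ℝ) :
    c i.castSucc (Fin.snoc (α := fun _ => ℝ) p x) = initInput c i p := by
  refine hc _ _ _ fun j hj => ?_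
  obtain ⟨k, rfl⟩ : ∃ k : Fin n, k.castSucc = j :=
    ⟨j.castPred (fun h => by simp [h, Fin.le_def] at hj; omega), by simp⟩
  simp

theorem IsCausal.initInput {c : Fin (n + 1) → (Fin (n + 1) → ℝ) → Bool} (hc : IsCausal c) :
    IsCausal (initInput c) := by
  intro i p p' h
  refine hc _ _ _ fun j hj => ?_
  obtain ⟨k, rfl⟩ : ∃ k : Fin n, k.castSucc = j :=
    ⟨j.castPred (fun h => by simp [h, Fin.le_def] at hj; omega), by simp⟩
  simpa using h k (by simpa using hj)

theorem integrable_snoc (hμ : ∀ᵐ p ∂μ, p ∈ Set.Icc (0 : ℝ) 1)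
    {c : Fin (n + 1) → (Fin (n + 1) → ℝ) → Bool} (hc : ∀ i, Measurable (c i)) (hcc : IsCausal c)
    (y : Fin n → Bool) (b : Bool) :
    Integrable (fun z : ℝ × (Fin n → ℝ) => (∏ i, bsc (z.2 i) (initInput c i z.2) (y i)) *
      bsc z.1 (c (Fin.last n) (Fin.snoc (α := fun _ => ℝ) z.2 z.1)) b)
      (μ.prod (Measure.pi fun _ => μ)) := by
  have h := ((measurePreserving_piFinSuccAbove (fun _ : Fin (n + 1) => μ)
    (Fin.last n)).symm _).integrable_comp_emb (MeasurableEquiv.measurableEmbedding _) |>.2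
    (integrable_prod_bsc hμ hc (Fin.snoc (α := fun _ => Bool) y b))
  refine h.congr (.of_forall fun z => ?_)
  simp [MeasurableEquiv.piFinSuccAbove, Fin.snocEquiv, Fin.prod_univ_castSucc, hcc.castSucc_snoc]

theorem likelihood_snoc (hμ : ∀ᵐ p ∂μ, p ∈ Set.Icc (0 : ℝ) 1)
    {c : Fin (n + 1) → (Fin (n + 1) → ℝ) → Bool} (hc : ∀ i, Measurable (c i)) (hcc : IsCausal c)
    (y : Fin n → Bool) (b : Bool) :
    likelihood μ c (Fin.snoc (α := fun _ => Bool) y b) =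
      ∫ p, (∏ i, bsc (p i) (initInput c i p) (y i)) *
        ∫ x, bsc x (c (Fin.last n) (Fin.snoc (α := fun _ => ℝ) p x)) b ∂μ
      ∂Measure.pi fun _ => μ := by
  simp_rw [← integral_const_mul]
  rw [← integral_prod_symm _ (integrable_snoc hμ hc hcc y b), likelihood,
    ← ((measurePreserving_piFinSuccAbove (fun _ : Fin (n + 1) => μ)
      (Fin.last n)).symm _).integral_comp']
  refine integral_congr_ae (.of_forall fun z => ?_)
  simp [MeasurableEquiv.piFinSuccAbove, Fin.snocEquiv, Fin.prod_univ_castSucc, hcc.castSucc_snoc]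

/-- The last state enters only the last factor. With the past states fixed, its integral is at most
the mean of `max p (1 - p)`, whatever the input rule. -/
theorem likelihood_snoc_le (hμ : ∀ᵐ p ∂μ, p ∈ Set.Icc (0 : ℝ) 1)
    {c : Fin (n + 1) → (Fin (n + 1) → ℝ) → Bool} (hc : ∀ i, Measurable (c i)) (hcc : IsCausal c)
    (y : Fin n → Bool) (b : Bool) :
    likelihood μ c (Fin.snoc (α := fun _ => Bool) y b) ≤
      (∫ p, max p (1 - p) ∂μ) * likelihood μ (initInput c) y := by
  rw [likelihood_snoc hμ hc hcc, mul_comm, likelihood, ← integral_mul_const]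
  have hint := (integrable_snoc hμ hc hcc y b).integral_prod_right
  simp_rw [integral_const_mul] at hint
  refine integral_mono_ae hint
    ((integrable_prod_bsc hμ (measurable_initInput hc) y).mul_const _) ?_
  filter_upwards [ae_pi_mem_Icc hμ n] with p hp
  refine mul_le_mul_of_nonneg_left ?_ (Finset.prod_nonneg fun i _ => bsc_nonneg (hp i) _ _)
  refine integral_mono (integrable_bsc hμ ?_ b) (integrable_max hμ) fun x => bsc_le_max x _ b
  exact (hc _).comp (measurable_snoc.comp measurable_prodMk_right)

theorem likelihood_snoc_true_add_false (hμ : ∀ᵐ p ∂μ, p ∈ Set.Icc (0 : ℝ) 1)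
    {c : Fin (n + 1) → (Fin (n + 1) → ℝ) → Bool} (hc : ∀ i, Measurable (c i)) (hcc : IsCausal c)
    (y : Fin n → Bool) :
    likelihood μ c (Fin.snoc (α := fun _ => Bool) y true) +
      likelihood μ c (Fin.snoc (α := fun _ => Bool) y false) = likelihood μ (initInput c) y := by
  have hint := fun b => (integrable_snoc hμ hc hcc y b).integral_prod_right
  simp_rw [integral_const_mul] at hint
  rw [likelihood_snoc hμ hc hcc, likelihood_snoc hμ hc hcc,
    ← integral_add (hint true) (hint false), likelihood]
  refine integral_congr_ae (.of_forall fun p => ?_)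
  have hm : Measurable fun x => c (Fin.last n) (Fin.snoc (α := fun _ => ℝ) p x) :=
    (hc _).comp (measurable_snoc.comp measurable_prodMk_right)
  simp only
  rw [← mul_add, ← integral_add (integrable_bsc hμ hm _) (integrable_bsc hμ hm _)]
  simp [bsc_true_add_bsc_false]

theorem integral_max_mem_Icc (hμ : ∀ᵐ p ∂μ, p ∈ Set.Icc (0 : ℝ) 1) :
    ∫ p, max p (1 - p) ∂μ ∈ Set.Icc (0 : ℝ) 1 := by
  have h0 : ∀ᵐ p ∂μ, 0 ≤ max p (1 - p) := hμ.mono fun p hp => le_max_of_le_left hp.1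
  refine ⟨integral_nonneg_of_ae h0, ?_⟩
  simpa using integral_mono_of_nonneg h0 (integrable_const (1 : ℝ))
    (hμ.mono fun p hp => max_le hp.2 (by linarith [hp.1]))

/-- Induction on `n`: the two extensions of an output word split its probability with neither share
above `q`, so `rpow_add_rpow_le` costs one factor per symbol. -/
theorem sum_likelihood_rpow_le (hμ : ∀ᵐ p ∂μ, p ∈ Set.Icc (0 : ℝ) 1) {r : ℝ} (hr : 1 ≤ r) {q : ℝ}
    (hq : ∫ p, max p (1 - p) ∂μ = q) {n : ℕ} {c : Fin n → (Fin n → ℝ) → Bool}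
    (hc : ∀ i, Measurable (c i)) (hcc : IsCausal c) :
    ∑ y, likelihood μ c y ^ r ≤ (q ^ r + (1 - q) ^ r) ^ n := by
  have hq01 : q ∈ Set.Icc (0 : ℝ) 1 := hq ▸ integral_max_mem_Icc hμ
  induction n with
  | zero => simp [likelihood]
  | succ n ih =>
    have h0 : 0 ≤ q ^ r + (1 - q) ^ r :=
      add_nonneg (Real.rpow_nonneg hq01.1 _) (Real.rpow_nonneg (sub_nonneg.2 hq01.2) _)
    rw [← (Fin.snocEquiv fun _ => Bool).sum_comp, Fintype.sum_prod_type_right, pow_succ]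
    refine le_trans ?_ (mul_le_mul_of_nonneg_right
      (ih (measurable_initInput hc) hcc.initInput) h0)
    rw [Finset.sum_mul]
    refine Finset.sum_le_sum fun y _ => ?_
    have hsum := likelihood_snoc_true_add_false hμ hc hcc y
    have hle := likelihood_snoc_le hμ hc hcc y
    rw [hq, ← hsum] at hle
    rw [Fintype.sum_bool, ← hsum]
    refine rpow_add_rpow_le hq01 hr ?_ (hle true) (hle false)
    exact (likelihood_nonneg hμ _ _).trans_eq hsum.symm

/-! ### The state law and its mean of `max p (1 - p)` -/

section Measure

variable {f : ℝ → ℝ}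

theorem isProbabilityMeasure_stateLaw (hf_nonneg : ∀ p, 0 ≤ f p) (hf_int : ∫ p, f p = 1) :
    IsProbabilityMeasure (stateLaw f) := by
  refine ⟨?_⟩
  rw [stateLaw, withDensity_apply _ .univ, Measure.restrict_univ,
    ← ofReal_integral_eq_lintegral_ofReal _ (.of_forall hf_nonneg), hf_int, ENNReal.ofReal_one]
  exact .of_integral_ne_zero (by simp [hf_int])

theorem ae_stateLaw_mem_Icc (hf_meas : Measurable f)
    (hf_supp : ∀ p, p ∉ Set.Icc (0 : ℝ) 1 → f p = 0) :
    ∀ᵐ p ∂stateLaw f, p ∈ Set.Icc (0 : ℝ) 1 := by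
  rw [stateLaw, ae_withDensity_iff hf_meas.ennreal_ofReal]
  refine .of_forall fun p hp => ?_
  by_contra h
  exact hp (by simp [hf_supp p h])

theorem integral_max_stateLaw (hf_meas : Measurable f) (hf_nonneg : ∀ p, 0 ≤ f p)
    (hf_supp : ∀ p, p ∉ Set.Icc (0 : ℝ) 1 → f p = 0) (hf_int : ∫ p, f p = 1) :
    ∫ p, max p (1 - p) ∂stateLaw f =
      (∫ p in (0 : ℝ)..(1 / 2), f p * (1 - p)) + ∫ p in (1 / 2 : ℝ)..1, f p * p := by
  have hfi : Integrable f := .of_integral_ne_zero (by simp [hf_int])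
  have hint : Integrable fun p => f p * max p (1 - p) := by
    refine hfi.mono (by fun_prop) (.of_forall fun p => ?_)
    by_cases hp : p ∈ Set.Icc (0 : ℝ) 1
    · rw [norm_mul, Real.norm_of_nonneg (le_max_of_le_left hp.1)]
      exact mul_le_of_le_one_right (norm_nonneg _) (max_le hp.2 (by linarith [hp.1]))
    · simp [hf_supp p hp]
  rw [stateLaw, integral_withDensity_eq_integral_toReal_smul hf_meas.ennreal_ofReal (by simp)]
  simp only [ENNReal.toReal_ofReal (hf_nonneg _), smul_eq_mul]
  rw [← setIntegral_eq_integral_of_forall_compl_eq_zero (s := Set.Icc (0 : ℝ) 1)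
    (fun p hp => by simp [hf_supp p hp]), integral_Icc_eq_integral_Ioc,
    ← intervalIntegral.integral_of_le zero_le_one,
    ← intervalIntegral.integral_add_adjacent_intervals (b := 1 / 2)
      hint.intervalIntegrable hint.intervalIntegrable]
  congr 1 <;> refine intervalIntegral.integral_congr fun p hp => ?_
  · rw [Set.uIcc_of_le (by norm_num)] at hp
    simp only [max_eq_right (show p ≤ 1 - p by linarith [hp.2])]
  · rw [Set.uIcc_of_le (by norm_num)] at hp
    simp only [max_eq_left (show 1 - p ≤ p by linarith [hp.1])]

end Measure

/-! ### Converse -/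

namespace CausalCode

variable {M n : ℕ} {f : ℝ → ℝ}

theorem measurable_codeword (C : CausalCode M n) (m : Fin M) (i : Fin n) :
    Measurable fun p => C.codeword m p i :=
  (C.measurable_enc i m).comp (measurable_pi_lambda _ fun j => measurable_pi_apply j.1)

theorem isCausal_codeword (C : CausalCode M n) (m : Fin M) :
    IsCausal fun i p => C.codeword m p i := by
  intro i p p' h
  exact congrArg (C.enc i m) (funext fun j => h j.1 j.2)

theorem errorProb_eq_sum [IsProbabilityMeasure (stateLaw f)]
    (hμ : ∀ᵐ p ∂stateLaw f, p ∈ Set.Icc (0 : ℝ) 1) (C : CausalCode M n) (m : Fin M) :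
    C.errorProb f m =
      ∑ y with C.dec y ≠ m, likelihood (stateLaw f) (fun i p => C.codeword m p i) y :=
  integral_finsetSum _ fun y _ => integrable_prod_bsc hμ (C.measurable_codeword m) y

theorem one_sub_errorProb [IsProbabilityMeasure (stateLaw f)]
    (hμ : ∀ᵐ p ∂stateLaw f, p ∈ Set.Icc (0 : ℝ) 1) (C : CausalCode M n) (m : Fin M) :
    1 - C.errorProb f m =
      ∑ y with C.dec y = m, likelihood (stateLaw f) (fun i p => C.codeword m p i) y := by
  rw [C.errorProb_eq_sum hμ m, ← sum_likelihood hμ (C.measurable_codeword m),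
    ← Finset.sum_filter_add_sum_filter_not _ (fun y => C.dec y = m), add_sub_cancel_right]

end CausalCode

/-- Markov-type truncation: values up to `τ` are paid for by `τ`, larger ones by their power. -/
theorem le_add_rpow_mul_rpow {w τ s : ℝ} (hw : 0 ≤ w) (hτ : 0 < τ) (hs : 0 < s) :
    w ≤ τ + τ ^ (-s) * w ^ (1 + s) := by
  rcases le_or_gt w τ with h | h
  · exact h.trans (le_add_of_nonneg_right (by positivity))
  · have hw' : 0 < w := hτ.trans h
    have h1 : 1 ≤ τ ^ (-s) * w ^ s := by
      rw [Real.rpow_neg hτ.le, inv_mul_eq_div, one_le_div (by positivity)]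
      exact Real.rpow_le_rpow hτ.le h.le hs.le
    rw [Real.rpow_add hw', Real.rpow_one]
    nlinarith

theorem le_rpow_mul_rpow_of_lt {w τ s : ℝ} (hw : 0 ≤ w) (h : w < τ) (hs : 0 < s) (hs1 : s < 1) :
    w ≤ τ ^ s * w ^ (1 - s) := by
  rcases hw.eq_or_lt with rfl | hw'
  · simp [Real.zero_rpow (sub_pos.2 hs1).ne']
  · calc w = w ^ s * w ^ (1 - s) := by rw [← Real.rpow_add hw', add_sub_cancel, Real.rpow_one]
      _ ≤ _ := mul_le_mul_of_nonneg_right (Real.rpow_le_rpow hw h.le hs.le) (by positivity)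

theorem CausalCode.one_sub_avgErrorProb_le {f : ℝ → ℝ} [IsProbabilityMeasure (stateLaw f)]
    (hμ : ∀ᵐ p ∂stateLaw f, p ∈ Set.Icc (0 : ℝ) 1) {q : ℝ}
    (hq : ∫ p, max p (1 - p) ∂stateLaw f = q) {M n : ℕ} (hM : 0 < M) (C : CausalCode M n)
    {τ s : ℝ} (hτ : 0 < τ) (hs : 0 < s) :
    1 - C.avgErrorProb f ≤
      τ * 2 ^ n / M + τ ^ (-s) * (q ^ (1 + s) + (1 - q) ^ (1 + s)) ^ n := by
  have hM' : (0 : ℝ) < M := by exact_mod_cast hM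
  set A := (q ^ (1 + s) + (1 - q) ^ (1 + s)) ^ n
  have hm : ∀ m, 1 - C.errorProb f m ≤
      (∑ y : Fin n → Bool with C.dec y = m, τ) + τ ^ (-s) * A := by
    intro m
    rw [C.one_sub_errorProb hμ m]
    have hnn := likelihood_nonneg hμ fun i p => C.codeword m p i
    refine (Finset.sum_le_sum fun y _ => le_add_rpow_mul_rpow (hnn y) hτ hs).trans ?_
    rw [Finset.sum_add_distrib, ← Finset.mul_sum]
    gcongr
    refine (Finset.sum_le_sum_of_subset_of_nonneg (Finset.filter_subset _ _) fun y _ _ =>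
      Real.rpow_nonneg (hnn y) _).trans ?_
    exact sum_likelihood_rpow_le hμ (by linarith) hq (C.measurable_codeword m)
      (C.isCausal_codeword m)
  have hsum := Finset.sum_le_sum fun m (_ : m ∈ Finset.univ) => hm m
  -- The decoding sets partition the outputs, so over all messages `τ` is counted `2 ^ n` times.
  rw [Finset.sum_add_distrib, Finset.sum_fiberwise] at hsum
  simp only [Finset.sum_sub_distrib, Finset.sum_const, Finset.card_univ, Fintype.card_fin,
    nsmul_eq_mul, mul_one, Fintype.card_pi, Fintype.card_bool, Finset.prod_const, Nat.cast_pow,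
    Nat.cast_ofNat] at hsum
  rw [avgErrorProb, ← sub_nonneg]
  have : τ * 2 ^ n / M + τ ^ (-s) * A - (1 - (∑ m, C.errorProb f m) / M) =
      (2 ^ n * τ + M * (τ ^ (-s) * A) - (M - ∑ m, C.errorProb f m)) / M := by
    field_simp
  rw [this]
  exact div_nonneg (sub_nonneg.2 hsum) hM'.le

theorem le_of_achievable {f : ℝ → ℝ} [IsProbabilityMeasure (stateLaw f)]
    (hμ : ∀ᵐ p ∂stateLaw f, p ∈ Set.Icc (0 : ℝ) 1) {q R : ℝ}
    (hq : ∫ p, max p (1 - p) ∂stateLaw f = q) (hR : Achievable f R) : R ≤ 1 - H2 q := by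
  by_contra! hlt
  obtain ⟨C, hC⟩ := hR
  have hq01 : q ∈ Set.Icc (0 : ℝ) 1 := hq ▸ integral_max_mem_Icc hμ
  -- With `τ = (2 ^ t) ^ n`, `t < R - 1` kills the counting term and `t > -H2 q` the tail term.
  obtain ⟨t, ht1, ht2⟩ := exists_between (show -H2 q < R - 1 by linarith)
  obtain ⟨s, hs, hs1⟩ := exists_tilt_lt_one hq01 ht1
  set A := q ^ (1 + s) + (1 - q) ^ (1 + s)
  have hA : 0 ≤ A :=
    add_nonneg (Real.rpow_nonneg hq01.1 _) (Real.rpow_nonneg (sub_nonneg.2 hq01.2) _)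
  have hb : (2 : ℝ) ^ t * 2 / 2 ^ R < 1 := by
    rw [div_lt_one (by positivity), ← Real.rpow_add_one two_ne_zero]
    exact Real.rpow_lt_rpow_of_exponent_lt one_lt_two (by linarith)
  have hlim := (tendsto_pow_atTop_nhds_zero_of_lt_one (by positivity) hb).add
    (tendsto_pow_atTop_nhds_zero_of_lt_one (by positivity) hs1)
  have hle := le_of_tendsto_of_tendsto' (hC.const_sub 1) hlim fun n => by
    refine ((C n).one_sub_avgErrorProb_le hμ hq (Nat.ceil_pos.2 (by positivity))
      (pow_pos (Real.rpow_pos_of_pos two_pos t) n) hs).trans ?_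
    rw [mul_pow, div_pow, mul_pow, Real.rpow_pow_comm (show (0 : ℝ) ≤ 2 ^ t by positivity),
      ← Real.rpow_mul_natCast two_pos.le R, mul_comm R]
    gcongr
    exact Nat.le_ceil _
  norm_num at hle

/-! ### Feinstein's greedy code construction -/

/-- The sequence in which each term is chosen by `g` from the set of the previous terms. -/
noncomputable def greedySeq {α : Type*} [DecidableEq α] (g : Finset α → α) : ℕ → α
  | m => g (Finset.univ.image fun j : Fin m => greedySeq g j)

section Feinstein

variable {X Y : Type*} {W : X → Y → ℝ} {τ : ℝ}

theorem card_threshold_le [Fintype Y] (hW : ∀ x y, 0 ≤ W x y) (hY : ∀ x, ∑ y, W x y = 1) (hτ : 0 < τ)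
    (x : X) : (Finset.card {y | τ ≤ W x y} : ℝ) ≤ 1 / τ := by
  rw [le_div_iff₀ hτ, ← nsmul_eq_mul, ← hY x]
  refine (Finset.card_nsmul_le_sum _ (W x) τ fun y hy => (Finset.mem_filter.1 hy).2).trans ?_
  exact Finset.sum_le_sum_of_subset_of_nonneg (Finset.filter_subset _ _) fun y _ _ => hW x y

/-- Averaging: the union `B` of the threshold sets has at most `S.card / τ` points, and since
columns sum to `1`, the mean over `x` of the mass given to `B` is `B.card / Fintype.card X`. -/
theorem exists_sum_threshold_le [Fintype X] [Fintype Y] [Nonempty X] (hW : ∀ x y, 0 ≤ W x y)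
    (hY : ∀ x, ∑ y, W x y = 1) (hX : ∀ y, ∑ x, W x y = 1) (hτ : 0 < τ) (S : Finset X) :
    ∃ x, ∑ y with ∃ z ∈ S, τ ≤ W z y, W x y ≤ S.card / (τ * Fintype.card X) := by
  classical
  set B : Finset Y := {y | ∃ z ∈ S, τ ≤ W z y}
  have hB : (B.card : ℝ) ≤ S.card * (1 / τ) := by
    have hsub : B ⊆ S.biUnion fun z => {y | τ ≤ W z y} := fun y hy => by simpa [B] using hy
    calc (B.card : ℝ) ≤ ∑ z ∈ S, (Finset.card {y | τ ≤ W z y} : ℝ) := by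
          exact_mod_cast (Finset.card_le_card hsub).trans Finset.card_biUnion_le
      _ ≤ ∑ z ∈ S, 1 / τ := Finset.sum_le_sum fun z _ => card_threshold_le hW hY hτ z
      _ = _ := by rw [Finset.sum_const, nsmul_eq_mul]
  have hcard : (0 : ℝ) < Fintype.card X := by exact_mod_cast Fintype.card_pos
  obtain ⟨x, -, hx⟩ := Finset.exists_le_of_sum_le (s := (Finset.univ : Finset X))
    (f := fun x => ∑ y ∈ B, W x y) (g := fun _ => S.card / (τ * Fintype.card X))
    Finset.univ_nonempty (by
      rw [Finset.sum_comm, Finset.sum_const, Finset.card_univ, nsmul_eq_mul]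
      simp only [hX, Finset.sum_const, nsmul_eq_mul, mul_one]
      refine hB.trans_eq ?_
      field_simp)
  exact ⟨x, hx⟩

theorem exists_seq_sum_threshold_le [Fintype X] [Fintype Y] [Nonempty X] (hW : ∀ x y, 0 ≤ W x y)
    (hY : ∀ x, ∑ y, W x y = 1) (hX : ∀ y, ∑ x, W x y = 1) (hτ : 0 < τ) :
    ∃ x : ℕ → X, ∀ m, ∑ y with ∃ j < m, τ ≤ W (x j) y, W (x m) y ≤ m / (τ * Fintype.card X) := by
  classical
  choose g hg using exists_sum_threshold_le hW hY hX hτ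
  refine ⟨greedySeq g, fun m => ?_⟩
  have h := hg (Finset.univ.image fun j : Fin m => greedySeq g j)
  have hc : ((Finset.univ.image fun j : Fin m => greedySeq g j).card : ℝ) ≤ m := by
    exact_mod_cast Finset.card_image_le.trans_eq (by simp)
  rw [greedySeq]
  refine le_trans (le_of_eq (Finset.sum_congr ?_ fun _ _ => rfl))
    (h.trans (div_le_div_of_nonneg_right hc (by positivity)))
  exact Finset.filter_congr fun y _ => by simp [Fin.exists_iff]

/-- Decode to the least index passing the test, or to `0` if none does. -/
theorem exists_first_decoder {M : ℕ} (hM : 0 < M) (P : Fin M → Y → Prop) :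
    ∃ D : Y → Fin M, ∀ y m, D y ≠ m → ¬ P m y ∨ ∃ j < m, P j y := by
  have h : ∀ y, ∃ d : Fin M, ∀ m, d ≠ m → ¬ P m y ∨ ∃ j < m, P j y := by
    intro y
    by_cases hy : ∃ m, P m y
    · obtain ⟨d, hd, hmin⟩ := wellFounded_lt.has_min {m | P m y} hy
      refine ⟨d, fun m hm => ?_⟩
      by_cases hPm : P m y
      · exact .inr ⟨d, lt_of_le_of_ne (not_lt.1 (hmin m hPm)) hm, hd⟩
      · exact .inl hPm
    · exact ⟨⟨0, hM⟩, fun m _ => .inl fun h => hy ⟨m, h⟩⟩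
  choose D hD using h
  exact ⟨D, hD⟩

/-- Feinstein's bound: a channel that preserves the uniform distribution has a code with `M`
codewords and small maximal error probability. -/
theorem exists_code_error_le [Fintype X] [Fintype Y] [Nonempty X] (hW : ∀ x y, 0 ≤ W x y)
    (hY : ∀ x, ∑ y, W x y = 1) (hX : ∀ y, ∑ x, W x y = 1) (hτ : 0 < τ) {s : ℝ} (hs : 0 < s)
    (hs1 : s < 1) {M : ℕ} (hM : 0 < M) :
    ∃ (x : Fin M → X) (D : Y → Fin M), ∀ m, ∑ y with D y ≠ m, W (x m) y ≤
      τ ^ s * ∑ y, W (x m) y ^ (1 - s) + M / (τ * Fintype.card X) := by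
  classical
  obtain ⟨x, hx⟩ := exists_seq_sum_threshold_le hW hY hX hτ
  obtain ⟨D, hD⟩ := exists_first_decoder hM fun (m : Fin M) y => τ ≤ W (x m) y
  refine ⟨fun m => x m, D, fun m => ?_⟩
  have hsub : (Finset.univ.filter fun y => D y ≠ m) ⊆
      (Finset.univ.filter fun y => W (x m) y < τ) ∪
        Finset.univ.filter fun y => ∃ j < (m : ℕ), τ ≤ W (x j) y := by
    intro y hy
    simp only [Finset.mem_union, Finset.mem_filter, Finset.mem_univ, true_and] at hy ⊢
    rcases hD y m hy with h | ⟨j, hj, h⟩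
    · exact .inl (not_le.1 h)
    · exact .inr ⟨j, hj, h⟩
  have hunion := Finset.sum_union_inter (s₁ := Finset.univ.filter fun y => W (x m) y < τ)
    (s₂ := Finset.univ.filter fun y => ∃ j < (m : ℕ), τ ≤ W (x j) y) (f := W (x m))
  have hinter := Finset.sum_nonneg fun y (_ : y ∈ (Finset.univ.filter fun y => W (x m) y < τ) ∩
    Finset.univ.filter fun y => ∃ j < (m : ℕ), τ ≤ W (x j) y) => hW (x m) y
  have hle := Finset.sum_le_sum_of_subset_of_nonneg hsub fun y _ _ => hW (x m) y
  have hsecond := (hx m).trans (div_le_div_of_nonneg_right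
    (show ((m : ℕ) : ℝ) ≤ M by exact_mod_cast m.2.le) (by positivity))
  have hfirst : ∑ y with W (x m) y < τ, W (x m) y ≤ τ ^ s * ∑ y, W (x m) y ^ (1 - s) := by
    rw [Finset.mul_sum]
    refine (Finset.sum_le_sum fun y hy => le_rpow_mul_rpow_of_lt (hW (x m) y)
      (Finset.mem_filter.1 hy).2 hs hs1).trans ?_
    exact Finset.sum_le_sum_of_subset_of_nonneg (Finset.filter_subset _ _) fun y _ _ =>
      mul_nonneg (by positivity) (Real.rpow_nonneg (hW _ _) _)
  linarith

end Feinstein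

/-! ### Achievability by flipping -/

theorem sum_prod_bsc_input {n : ℕ} (e : ℝ) (y : Fin n → Bool) :
    ∑ x : Fin n → Bool, ∏ i, bsc e (x i) (y i) = 1 := by
  have h : ∀ x y, bsc e x y = bsc e y x := fun x y => by simp only [bsc, eq_comm]
  simp_rw [h _ (y _)]
  exact sum_prod_bsc (fun _ => e) y

theorem sum_prod_bsc_rpow {n : ℕ} {q : ℝ} (hq : q ∈ Set.Icc (0 : ℝ) 1) (x : Fin n → Bool) (r : ℝ) :
    ∑ y : Fin n → Bool, (∏ i, bsc (1 - q) (x i) (y i)) ^ r = (q ^ r + (1 - q) ^ r) ^ n := by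
  have hq' : 1 - q ∈ Set.Icc (0 : ℝ) 1 := ⟨by linarith [hq.2], by linarith [hq.1]⟩
  have h : ∀ x, bsc (1 - q) x true ^ r + bsc (1 - q) x false ^ r = q ^ r + (1 - q) ^ r := by
    intro x
    cases x <;> simp [bsc, add_comm]
  simp_rw [← Real.finsetProd_rpow _ _ (fun i _ => bsc_nonneg hq' _ _)]
  rw [← Fintype.prod_sum fun i b => bsc (1 - q) (x i) b ^ r]
  simp [h]

/-- The code that flips the symbols of a block code whenever the crossover probability exceeds
`1 / 2`. -/
noncomputable def flipCode {M n : ℕ} (x : Fin M → Fin n → Bool) (D : (Fin n → Bool) → Fin M) :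
    CausalCode M n where
  enc i m p := xor (x m i) (decide (1 / 2 < p ⟨i, Set.self_mem_Iic⟩))
  measurable_enc i m := by
    refine (measurable_of_countable (xor (x m i))).comp ?_
    refine measurable_to_bool ?_
    have : (fun p : Set.Iic i → ℝ => decide (1 / 2 < p ⟨i, Set.self_mem_Iic⟩)) ⁻¹' {true} =
        {p | 1 / 2 < p ⟨i, Set.self_mem_Iic⟩} := by
      ext; simp
    rw [this]
    exact measurableSet_lt measurable_const (measurable_pi_apply _)
  dec := D

/-- Flipping turns crossover `p` into `min p (1 - p)`, written here as `1 - max p (1 - p)`. -/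
theorem bsc_xor_flip (p : ℝ) (x y : Bool) :
    bsc p (xor x (decide (1 / 2 < p))) y = bsc (1 - max p (1 - p)) x y := by
  rcases lt_or_ge (1 / 2) p with h | h
  · rw [max_eq_left (by linarith), decide_eq_true h]
    cases x <;> cases y <;> simp [bsc]
  · rw [max_eq_right (by linarith), decide_eq_false (not_lt.2 h)]
    simp

theorem integral_bsc {μ : Measure ℝ} [IsProbabilityMeasure μ] {g : ℝ → ℝ} (hg : Integrable g μ)
    (x y : Bool) : ∫ p, bsc (g p) x y ∂μ = bsc (∫ p, g p ∂μ) x y := by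
  unfold bsc
  split_ifs
  · rw [integral_sub (integrable_const _) hg]
    simp
  · rfl

/-- Each input uses only its own state, so the integral factorizes; `bsc` is affine in the
crossover, so averaging acts on the crossover alone. -/
theorem likelihood_flipCode {μ : Measure ℝ} [IsProbabilityMeasure μ]
    (hμ : ∀ᵐ p ∂μ, p ∈ Set.Icc (0 : ℝ) 1) {q : ℝ} (hq : ∫ p, max p (1 - p) ∂μ = q) {M n : ℕ}
    (x : Fin M → Fin n → Bool) (D : (Fin n → Bool) → Fin M) (m : Fin M) (y : Fin n → Bool) :
    likelihood μ (fun i p => (flipCode x D).codeword m p i) y =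
      ∏ i, bsc (1 - q) (x m i) (y i) := by
  have hmax : Integrable (fun p => max p (1 - p)) μ := integrable_max hμ
  simp only [likelihood, CausalCode.codeword, flipCode, bsc_xor_flip]
  rw [integral_fintype_prod_eq_prod (μ := fun _ => μ)
    fun i p => bsc (1 - max p (1 - p)) (x m i) (y i)]
  refine Finset.prod_congr rfl fun i _ => ?_
  rw [integral_bsc (g := fun p => 1 - max p (1 - p)) ((integrable_const _).sub hmax),
    integral_sub (integrable_const _) hmax, hq]
  simp

theorem exists_avgErrorProb_le {f : ℝ → ℝ} [IsProbabilityMeasure (stateLaw f)]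
    (hμ : ∀ᵐ p ∂stateLaw f, p ∈ Set.Icc (0 : ℝ) 1) {q : ℝ}
    (hq : ∫ p, max p (1 - p) ∂stateLaw f = q) {M : ℕ} (n : ℕ) (hM : 0 < M) {τ s : ℝ}
    (hτ : 0 < τ) (hs : 0 < s) (hs1 : s < 1) :
    ∃ C : CausalCode M n, C.avgErrorProb f ≤
      τ ^ s * (q ^ (1 - s) + (1 - q) ^ (1 - s)) ^ n + M / (τ * 2 ^ n) := by
  have hq01 : q ∈ Set.Icc (0 : ℝ) 1 := hq ▸ integral_max_mem_Icc hμ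
  have hq' : 1 - q ∈ Set.Icc (0 : ℝ) 1 := ⟨by linarith [hq01.2], by linarith [hq01.1]⟩
  obtain ⟨x, D, h⟩ := exists_code_error_le
    (W := fun x y : Fin n → Bool => ∏ i, bsc (1 - q) (x i) (y i))
    (fun x y => Finset.prod_nonneg fun i _ => bsc_nonneg hq' _ _)
    (fun x => sum_prod_bsc (fun _ => 1 - q) x) (sum_prod_bsc_input _) hτ hs hs1 hM
  refine ⟨flipCode x D, ?_⟩
  have hM' : (0 : ℝ) < M := by exact_mod_cast hM
  have hm : ∀ m, (flipCode x D).errorProb f m ≤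
      τ ^ s * (q ^ (1 - s) + (1 - q) ^ (1 - s)) ^ n + M / (τ * 2 ^ n) := by
    intro m
    rw [CausalCode.errorProb_eq_sum hμ]
    simp_rw [likelihood_flipCode hμ hq]
    simpa [sum_prod_bsc_rpow hq01, flipCode] using h m
  rw [CausalCode.avgErrorProb, div_le_iff₀ hM']
  refine (Finset.sum_le_sum fun m _ => hm m).trans_eq ?_
  rw [Finset.sum_const, Finset.card_univ, Fintype.card_fin, nsmul_eq_mul, mul_comm]

theorem CausalCode.avgErrorProb_nonneg {f : ℝ → ℝ} [IsProbabilityMeasure (stateLaw f)]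
    (hμ : ∀ᵐ p ∂stateLaw f, p ∈ Set.Icc (0 : ℝ) 1) {M n : ℕ} (C : CausalCode M n) :
    0 ≤ C.avgErrorProb f := by
  refine div_nonneg (Finset.sum_nonneg fun m _ => ?_) (Nat.cast_nonneg _)
  rw [C.errorProb_eq_sum hμ]
  exact Finset.sum_nonneg fun y _ => likelihood_nonneg hμ _ y

theorem achievable_of_lt {f : ℝ → ℝ} [IsProbabilityMeasure (stateLaw f)]
    (hμ : ∀ᵐ p ∂stateLaw f, p ∈ Set.Icc (0 : ℝ) 1) {q R : ℝ}
    (hq : ∫ p, max p (1 - p) ∂stateLaw f = q) (hR0 : 0 ≤ R) (hR : R < 1 - H2 q) :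
    Achievable f R := by
  have hq01 : q ∈ Set.Icc (0 : ℝ) 1 := hq ▸ integral_max_mem_Icc hμ
  obtain ⟨t, ht1, ht2⟩ := exists_between (show R - 1 < -H2 q by linarith)
  obtain ⟨s, hs, hs1, hlt⟩ := exists_neg_tilt_lt_one hq01 ht2
  set A := q ^ (1 - s) + (1 - q) ^ (1 - s)
  have hA : 0 ≤ A :=
    add_nonneg (Real.rpow_nonneg hq01.1 _) (Real.rpow_nonneg (sub_nonneg.2 hq01.2) _)
  have hb : (2 : ℝ) ^ R / (2 ^ t * 2) < 1 := by
    rw [div_lt_one (by positivity), ← Real.rpow_add_one two_ne_zero]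
    exact Real.rpow_lt_rpow_of_exponent_lt one_lt_two (by linarith)
  have hlim := (tendsto_pow_atTop_nhds_zero_of_lt_one (by positivity) hlt).add
    -- The factor `2` absorbs the ceiling: `⌈x⌉ ≤ x + 1 ≤ 2 * x` for `x ≥ 1`.
    ((tendsto_pow_atTop_nhds_zero_of_lt_one (by positivity) hb).const_mul 2)
  rw [mul_zero, add_zero] at hlim
  choose C hC using fun n : ℕ => exists_avgErrorProb_le (M := ⌈(2 : ℝ) ^ ((n : ℝ) * R)⌉₊) hμ hq n
    (Nat.ceil_pos.2 (by positivity)) (pow_pos (Real.rpow_pos_of_pos two_pos t) n) hs hs1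
  refine ⟨C, squeeze_zero (fun n => (C n).avgErrorProb_nonneg hμ) (fun n => (hC n).trans ?_) hlim⟩
  rw [mul_pow, div_pow, mul_pow, Real.rpow_pow_comm (show (0 : ℝ) ≤ 2 ^ t by positivity),
    ← mul_div_assoc, ← Real.rpow_mul_natCast two_pos.le R, mul_comm R]
  gcongr
  have h1 : (1 : ℝ) ≤ 2 ^ ((n : ℝ) * R) := Real.one_le_rpow one_le_two (by positivity)
  linarith [Nat.ceil_lt_add_one (zero_le_one.trans h1)]

/-- With a single message no error is possible. This covers zero capacity, where `achievable_of_lt`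
gives no rate. -/
theorem achievable_zero {f : ℝ → ℝ} [IsProbabilityMeasure (stateLaw f)]
    (hμ : ∀ᵐ p ∂stateLaw f, p ∈ Set.Icc (0 : ℝ) 1) : Achievable f 0 := by
  have hM : ∀ n : ℕ, ⌈(2 : ℝ) ^ ((n : ℝ) * 0)⌉₊ = 1 := by simp
  have hsub : ∀ n : ℕ, Subsingleton (Fin ⌈(2 : ℝ) ^ ((n : ℝ) * 0)⌉₊) := fun n => by
    rw [hM]; infer_instance
  refine ⟨fun n => flipCode (fun _ _ => true) fun _ => ⟨0, by simp⟩, ?_⟩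
  refine tendsto_const_nhds.congr fun n => ?_
  have := hsub n
  rw [CausalCode.avgErrorProb, Finset.sum_eq_zero, zero_div]
  intro m _
  rw [CausalCode.errorProb_eq_sum hμ, Finset.filter_false_of_mem, Finset.sum_empty]
  exact fun y _ h => h (Subsingleton.elim _ _)

end VBSC

theorem mainTheorem1 (f : ℝ → ℝ) (hf_meas : Measurable f) (hf_nonneg : ∀ p, 0 ≤ f p)
    (hf_supp : ∀ p, p ∉ Set.Icc (0 : ℝ) 1 → f p = 0) (hf_int : ∫ p, f p = 1) :
    VBSC.IsCausalCapacity f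
      (1 - H2 ((∫ p in (0 : ℝ)..(1 / 2), f p * (1 - p)) + ∫ p in (1 / 2 : ℝ)..1, f p * p)) := by
  have := VBSC.isProbabilityMeasure_stateLaw hf_nonneg hf_int
  have hμ := VBSC.ae_stateLaw_mem_Icc hf_meas hf_supp
  have hq := VBSC.integral_max_stateLaw hf_meas hf_nonneg hf_supp hf_int
  refine ⟨fun R hR => VBSC.le_of_achievable hμ hq hR.2, fun c hc => ?_⟩
  refine le_of_forall_lt fun R hR => ?_
  obtain ⟨R', hRR', hR'⟩ := exists_between hR
  -- Only nonnegative rates count, so for negative `R'` rate `0` serves as the witness.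
  rcases le_or_gt 0 R' with h0 | h0
  · exact hRR'.trans_le (hc ⟨h0, VBSC.achievable_of_lt hμ hq h0 hR'⟩)
  · exact (hRR'.trans h0).trans_le (hc ⟨le_rfl, VBSC.achievable_zero hμ⟩)
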